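/- Let $D=\{|\xi|<1\}$ and $n\ge 2$. Let $f_n(\xi,t)=\sum_{i=1}^n a_i(t)\xi^i$, $t\in[0,\infty)$, be polynomials in $\xi$ of degree exactly $n$ that form a global solution of the zero-surface-tension Stokes flow problem with injection of strength $2\pi$ at the origin, i.e. (1) for every $t\ge 0$, $f_n(\cdot,t)$ is analytic and univalent (injective) on $\overline D$, with $f_n(0,t)=0$ and $f_n'(0,t)>0$ (prime denotes $\partial/\partial\xi$); (2) for every $\xi\in\overline D$, $f_n(\xi,t)$ is continuously differentiable in $t\in[0,\infty)$; (3) for every $t\ge0$, $$\frac{\partial}{\partial t}\Big[f_n'(\xi,t)\,\overline{f_n}\big(\tfrac1\xi,t\big)\Big]+2\Lambda'(\xi,t)=0,\qquad |\xi|=1,$$ where $\overline{f_n}(z,t)=\overline{f_n(\bar z,t)}$ and $\Lambda(\xi,t)=\chi(f_n(\xi,t),t)$ for some (multivalued) $\chi(\cdot,t)$ of the form $\chi(z,t)=-\log z+R(z,t)$ with $R(\cdot,t)$ analytic on $\Omega(t)=f_n(D,t)$; the values of $\Lambda'$ on $|\xi|=1$ are its limits from inside $D$. For $k\ge 0$ set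 $$C_k(t)=\frac1{2\pi i}\int_{|\xi|=1}\xi^k f_n'(\xi,t)\,\overline{f_n}\big(\tfrac1\xi,t\big)\,d\xi .$$ Then, for every $k\ge1$, $C_k(t)=C_k(0)=:C_k$ for all $t\ge0$; and $$\lim_{t\to\infty}\Big[f_n(\xi,t)-\sqrt{2t+C_0(0)}\;\xi\Big]\sqrt{2t}=\sum_{k=2}^n\overline{C_{k-1}}\,\xi^k$$ locally uniformly in $\xi\in\mathbb C$, where $C_0(0)$ is real and the limit polynomial is not identically zero. -/

import Mathlib

open Filter Topology Set Metric
open scoped ComplexConjugate Real Polynomial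

noncomputable section

/-- The class `O(E)`: analytic and univalent on `E`, `f(0) = 0` and `f'(0) > 0`. -/
structure UnivalentNormalized (E : Set ℂ) (f : ℂ → ℂ) : Prop where
  analytic : AnalyticOnNhd ℂ f E
  univalent : InjOn f E
  map_zero : f 0 = 0
  deriv_zero_im : (deriv f 0).im = 0
  deriv_zero_re : 0 < (deriv f 0).re

/-- `conjReflect f ξ` is `f̄(1/ξ)`, where `f̄(z)` is the complex conjugate of `f(conj z)`. -/
def conjReflect (f : ℂ → ℂ) (ξ : ℂ) : ℂ := conj (f (conj (1 / ξ)))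

/-- The function `ξ ↦ f'(ξ) f̄(1/ξ)`. -/
def stokesDensity (f : ℂ → ℂ) (ξ : ℂ) : ℂ := deriv f ξ * conjReflect f ξ

/-- `dχ` is the derivative on `Ω \ {0}` of a function `χ` that is analytic there up to a
logarithmic singularity `χ(z) ∼ - log z` at the origin, that is, `χ(z) = - log z + R(z)`
with `R` analytic on `Ω`. (`χ` itself is multivalued; its derivative is not.) -/
def IsDerivOfLogSource (Ω : Set ℂ) (dχ : ℂ → ℂ) : Prop :=
  ∃ R : ℂ → ℂ, DifferentiableOn ℂ R Ω ∧ ∀ z ∈ Ω \ {0}, dχ z = -(1 / z) + deriv R z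

/-- A global solution, `t ∈ [0, ∞)`, of the zero surface tension Stokes injection equation
`∂/∂t [f'(ξ,t) f̄(1/ξ,t)] + 2 Λ'(ξ,t) = 0` for `|ξ| = 1`, where `Λ(ξ,t) = χ(f(ξ,t), t)`.
The values of `Λ'` on the unit circle are its boundary values from inside the disc. -/
structure IsGlobalStokesSolution (f : ℂ → ℝ → ℂ) : Prop where
  univalentNormalized : ∀ t : ℝ, 0 ≤ t →
    UnivalentNormalized (closedBall 0 1) (fun ξ => f ξ t)
  contDiff_time : ∀ ξ ∈ closedBall (0 : ℂ) 1, ContDiffOn ℝ 1 (fun t => f ξ t) (Ici 0)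
  equation : ∀ t : ℝ, 0 ≤ t →
    ∃ dχ : ℂ → ℂ, IsDerivOfLogSource ((fun ξ => f ξ t) '' ball 0 1) dχ ∧
      ∀ ξ ∈ sphere (0 : ℂ) 1, ∃ dΛ : ℂ,
        Tendsto (fun η => dχ (f η t) * deriv (fun ζ => f ζ t) η) (𝓝[ball 0 1] ξ) (𝓝 dΛ) ∧
        ∃ D : ℂ,
          HasDerivWithinAt (fun s : ℝ => stokesDensity (fun ζ => f ζ s) ξ) D (Ici 0) t ∧
          D + 2 * dΛ = 0

/-- `C_k(t) = (1 / 2πi) ∫_{|ξ| = 1} ξ^k f'(ξ,t) f̄(1/ξ,t) dξ`. -/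
def stokesMoment (f : ℂ → ℝ → ℂ) (k : ℕ) (t : ℝ) : ℂ :=
  (2 * (π : ℂ) * Complex.I)⁻¹ *
    ∮ ξ in C((0 : ℂ), 1), ξ ^ k * stokesDensity (fun ζ => f ζ t) ξ

end

/-!
Write `f(ξ, t) = ∑ a_i(t) ξ^i`. On the unit circle `f'(ξ) conj f(ξ)` is a Laurent polynomial in `ξ`,
and its coefficients give `C_k = ∑ i a_i conj a_{i+k}` (`stokesMoment_eq_sum`). The boundary
function `Λ'` equals `-1/ξ + G(ξ)` with `G` holomorphic in the disc and continuous up to the circle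
(`IsDerivOfLogSource.exists_diffContOnCl`), so multiplying the equation by `ξ^k` and integrating
gives, by Cauchy's theorem, `C_0' = 2` and `C_k' = 0` for `k ≥ 1`
(`IsGlobalStokesSolution.hasDerivWithinAt_stokesMoment`). Differentiation under the integral sign is
not needed: the `a_i` are fixed linear combinations of values `f(ξ_j, t)` with `ξ_j` in the closed
disc, hence differentiable in `t`.

Univalence says that `f(ξ)/ξ` has no zero in the disc, so `|a_i| ≤ 2^n a_1`
(`UnivalentNormalized.norm_coeff_le`). As `C_0 = ∑ i |a_i|²` grows like `2t`, it follows that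
`a_1 → ∞`. In `C_k = a_1 conj a_{k+1} + ∑_{i ≥ 2} i a_i conj a_{i+k}` the left side is constant, so
division by `a_1` and descending induction on the index give `a_i → 0` for all `i ≥ 2`
(`CoeffFlow.tendsto_zero`). Put back into the moment identities, this yields
`a_1 conj a_{k+1} → C_k`, and `a_1² = 2t + C_0(0) - o(1)`, whence the coefficientwise limits
(`CoeffFlow.tendsto_mul_sqrt`, `CoeffFlow.tendsto_one_sub_sqrt_mul_sqrt`). The limit is not zero
because `C_{n-1} = a_1 conj a_n` and `f` has degree exactly `n`.
-/

/-! ### Moments of a polynomial map -/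

/-- Integration against `ξ ^ k` picks the coefficients of `ξ ^ (-k - 1)`, that is, the pairs with
`j = i + k`. -/
theorem circleIntegral_pow_mul_laurent_sum (n k : ℕ) (c : ℕ → ℕ → ℂ) :
    (2 * (π : ℂ) * Complex.I)⁻¹ * (∮ ξ in C((0 : ℂ), 1), ξ ^ k *
      ∑ i ∈ Finset.range (n + 1), ∑ j ∈ Finset.range (n + 1), c i j * ξ ^ ((i : ℤ) - 1 - j)) =
      ∑ i ∈ Finset.range (n + 1), ∑ j ∈ Finset.range (n + 1), if i + k = j then c i j else 0 := by
  have hint : ∀ i j : ℕ,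
      CircleIntegrable (fun ξ : ℂ => c i j * ξ ^ ((k : ℤ) + i - 1 - j)) 0 1 := by
    intro i j
    refine CircleIntegrable.const_fun_smul (a := c i j) ?_
    simpa using (circleIntegrable_sub_zpow_iff (c := 0) (w := 0) (R := 1)
      (n := (k : ℤ) + i - 1 - j)).2 (by simp)
  have hcongr : (∮ ξ in C((0 : ℂ), 1), ξ ^ k *
      ∑ i ∈ Finset.range (n + 1), ∑ j ∈ Finset.range (n + 1), c i j * ξ ^ ((i : ℤ) - 1 - j)) =
      ∮ ξ in C((0 : ℂ), 1), ∑ i ∈ Finset.range (n + 1), ∑ j ∈ Finset.range (n + 1),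
        c i j * ξ ^ ((k : ℤ) + i - 1 - j) := by
    refine circleIntegral.integral_congr zero_le_one fun ξ hξ => ?_
    have hξ0 : ξ ≠ 0 := ne_of_mem_sphere hξ one_ne_zero
    simp only [Finset.mul_sum]
    refine Finset.sum_congr rfl fun i _ => Finset.sum_congr rfl fun j _ => ?_
    rw [show (k : ℤ) + i - 1 - j = k + (i - 1 - j) by ring, zpow_add₀ hξ0, zpow_natCast]
    ring
  rw [hcongr, circleIntegral.integral_fun_sum
    (fun i _ => CircleIntegrable.fun_sum _ fun j _ => hint i j), Finset.mul_sum]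
  refine Finset.sum_congr rfl fun i _ => ?_
  rw [circleIntegral.integral_fun_sum (fun j _ => hint i j), Finset.mul_sum]
  refine Finset.sum_congr rfl fun j _ => ?_
  rw [circleIntegral.integral_const_mul]
  split_ifs with h
  · have : (k : ℤ) + i - 1 - j = -1 := by omega
    have h2 := circleIntegral.integral_sub_center_inv (0 : ℂ) (one_ne_zero (α := ℝ))
    simp only [sub_zero] at h2
    simp only [this, zpow_neg_one, h2]
    field_simp [Complex.two_pi_I_ne_zero]
  · have : (k : ℤ) + i - 1 - j ≠ -1 := by omega
    have h2 := circleIntegral.integral_sub_zpow_of_ne this 0 0 1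
    simp only [sub_zero] at h2
    rw [h2, mul_zero, mul_zero]

theorem sum_sum_ite_add_eq (n k : ℕ) (c : ℕ → ℕ → ℂ) (hc : ∀ i j, n < j → c i j = 0) :
    (∑ i ∈ Finset.range (n + 1), ∑ j ∈ Finset.range (n + 1), if i + k = j then c i j else 0) =
      ∑ i ∈ Finset.range (n + 1), c i (i + k) := by
  refine Finset.sum_congr rfl fun i _ => ?_
  rw [Finset.sum_ite_eq]
  split_ifs with h
  · rfl
  · exact (hc _ _ (by simpa using h)).symm

theorem conjReflect_eq_of_mem_sphere (g : ℂ → ℂ) {ξ : ℂ} (hξ : ξ ∈ sphere (0 : ℂ) 1) :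
    conjReflect g ξ = conj (g ξ) := by
  have h1 : ‖ξ‖ = 1 := by simpa using hξ
  rw [conjReflect, one_div, Complex.inv_eq_conj h1, Complex.conj_conj]

theorem stokesDensity_eval_eq_sum {n : ℕ} {q : ℂ[X]} (hq : q.natDegree ≤ n) {ξ : ℂ}
    (hξ : ξ ∈ sphere (0 : ℂ) 1) :
    stokesDensity (fun ζ => q.eval ζ) ξ = ∑ i ∈ Finset.range (n + 1), ∑ j ∈ Finset.range (n + 1),
      (i * q.coeff i * conj (q.coeff j)) * ξ ^ ((i : ℤ) - 1 - j) := by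
  have h1 : ‖ξ‖ = 1 := by simpa using hξ
  have h0 : ξ ≠ 0 := ne_of_mem_sphere hξ one_ne_zero
  have hd : q.derivative.eval ξ =
      ∑ i ∈ Finset.range (n + 1), (i * q.coeff i) * ξ ^ ((i : ℤ) - 1) := by
    rw [Polynomial.derivative_eval, Polynomial.sum_over_range' q (by simp) (n + 1) (by omega)]
    refine Finset.sum_congr rfl fun i _ => ?_
    rcases i with _ | i
    · simp
    · rw [Nat.add_sub_cancel, show (((i + 1 : ℕ) : ℤ) - 1) = (i : ℤ) by push_cast; ring,
        zpow_natCast]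
      ring
  have hc : conj (q.eval ξ) = ∑ j ∈ Finset.range (n + 1), conj (q.coeff j) * ξ ^ (-(j : ℤ)) := by
    rw [Polynomial.eval_eq_sum_range' (Nat.lt_succ_of_le hq), map_sum]
    refine Finset.sum_congr rfl fun j _ => ?_
    rw [map_mul, map_pow, ← Complex.inv_eq_conj h1, zpow_neg, zpow_natCast, inv_pow]
  rw [stokesDensity, conjReflect_eq_of_mem_sphere _ hξ, Polynomial.deriv, hd, hc,
    Finset.sum_mul_sum]
  refine Finset.sum_congr rfl fun i _ => Finset.sum_congr rfl fun j _ => ?_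
  rw [show (i : ℤ) - 1 - j = (i - 1) + -j by ring, zpow_add₀ h0]
  ring

theorem stokesMoment_eq_sum_sum {n : ℕ} {p : ℝ → ℂ[X]} {f : ℂ → ℝ → ℂ}
    (hf : ∀ (ξ : ℂ) (t : ℝ), f ξ t = (p t).eval ξ) {t : ℝ} (hdeg : (p t).natDegree ≤ n) (k : ℕ) :
    stokesMoment f k t = ∑ i ∈ Finset.range (n + 1), ∑ j ∈ Finset.range (n + 1),
      if i + k = j then i * (p t).coeff i * conj ((p t).coeff j) else 0 := by
  rw [← circleIntegral_pow_mul_laurent_sum n k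
    (fun i j => i * (p t).coeff i * conj ((p t).coeff j)), stokesMoment]
  congr 1
  refine circleIntegral.integral_congr zero_le_one fun ξ hξ => ?_
  simp only [hf]
  rw [stokesDensity_eval_eq_sum hdeg hξ]

theorem stokesMoment_eq_sum {n : ℕ} {p : ℝ → ℂ[X]} {f : ℂ → ℝ → ℂ}
    (hf : ∀ (ξ : ℂ) (t : ℝ), f ξ t = (p t).eval ξ) {t : ℝ} (hdeg : (p t).natDegree ≤ n) (k : ℕ) :
    stokesMoment f k t =
      ∑ i ∈ Finset.range (n + 1), i * (p t).coeff i * conj ((p t).coeff (i + k)) := by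
  rw [stokesMoment_eq_sum_sum hf hdeg]
  refine sum_sum_ite_add_eq n k (fun i j => i * (p t).coeff i * conj ((p t).coeff j)) ?_
  intro i j hj
  rw [Polynomial.coeff_eq_zero_of_natDegree_lt (hdeg.trans_lt hj), map_zero, mul_zero]

/-! ### The evolution of the moments -/

/-- The singularity of `Λ'` at the origin is exactly `-1/ξ`, whatever the map: if `F` is normalized
univalent then `F'/F - 1/ξ` is holomorphic in the disc. The remainder `G` extends continuously to
the circle because `Λ'` has limits there from inside. -/
theorem IsDerivOfLogSource.exists_diffContOnCl {F dχ L : ℂ → ℂ}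
    (hF : UnivalentNormalized (closedBall 0 1) F) (hχ : IsDerivOfLogSource (F '' ball 0 1) dχ)
    (hL : ∀ ξ ∈ sphere (0 : ℂ) 1,
      Tendsto (fun η => dχ (F η) * deriv F η) (𝓝[ball 0 1] ξ) (𝓝 (L ξ))) :
    ∃ G : ℂ → ℂ, DiffContOnCl ℂ G (ball 0 1) ∧
      ∀ ξ ∈ sphere (0 : ℂ) 1, L ξ = -(1 / ξ) + G ξ := by
  obtain ⟨R, hR, hdχ⟩ := hχ
  have han : AnalyticOnNhd ℂ F (ball 0 1) := hF.analytic.mono ball_subset_closedBall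
  have hdF : DifferentiableOn ℂ F (ball 0 1) := han.differentiableOn
  have hinj : InjOn F (ball 0 1) := hF.univalent.mono ball_subset_closedBall
  have h0 : (0 : ℂ) ∈ ball (0 : ℂ) 1 := by simp
  have hopen : IsOpen (F '' ball 0 1) := by
    rcases han.is_constant_or_isOpen (convex_ball 0 1).isPreconnected with ⟨w, hw⟩ | h
    · have h2 : (2⁻¹ : ℂ) ∈ ball (0 : ℂ) 1 := by
        rw [mem_ball_zero_iff]; norm_num
      exact absurd (hinj h0 h2 (by rw [hw _ h0, hw _ h2])) (by norm_num)
    · exact h _ subset_rfl isOpen_ball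
  -- `q = F/ξ`, with value `F'(0)` at the origin; thus `F'/F = 1/ξ + q'/q`.
  set q : ℂ → ℂ := dslope F 0 with hq
  have hqd : DifferentiableOn ℂ q (ball 0 1) :=
    (Complex.differentiableOn_dslope (ball_mem_nhds 0 one_pos)).2 hdF
  have hFq : ∀ η, F η = η * q η := by
    intro η
    have := sub_smul_dslope F 0 η
    simpa [hF.map_zero] using this.symm
  have hq0 : ∀ η ∈ ball (0 : ℂ) 1, q η ≠ 0 := by
    intro η hη hqη
    rcases eq_or_ne η 0 with rfl | hne
    · rw [hq, dslope_same] at hqη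
      have := hF.deriv_zero_re
      rw [hqη] at this
      simp at this
    · exact hne (hinj hη h0 (by rw [hFq η, hqη, mul_zero, hF.map_zero]))
  set G₀ : ℂ → ℂ := fun η => -(deriv q η / q η) + deriv R (F η) * deriv F η with hG₀
  have hG₀d : DifferentiableOn ℂ G₀ (ball 0 1) :=
    (((hqd.deriv isOpen_ball).div hqd hq0).neg).add
      (((hR.deriv hopen).comp hdF (mapsTo_image _ _)).mul (hdF.deriv isOpen_ball))
  have hΛ : ∀ η ∈ ball (0 : ℂ) 1, η ≠ 0 → G₀ η = dχ (F η) * deriv F η + 1 / η := by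
    intro η hη hne
    have hFne : F η ≠ 0 := by rw [hFq]; exact mul_ne_zero hne (hq0 η hη)
    have hqη := hq0 η hη
    have hderiv : deriv F η = q η + η * deriv q η := by
      have h1 : HasDerivAt (fun η => η * q η) (1 * q η + η * deriv q η) η :=
        (hasDerivAt_id η).mul ((hqd.differentiableAt (isOpen_ball.mem_nhds hη)).hasDerivAt)
      rw [show F = fun η => η * q η from funext hFq, h1.deriv, one_mul]
    rw [hdχ _ ⟨mem_image_of_mem _ hη, hFne⟩, hG₀]
    simp only
    rw [add_mul, add_right_comm]
    congr 1
    rw [hderiv, hFq]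
    field_simp
    ring
  have hlim : ∀ ξ ∈ sphere (0 : ℂ) 1, Tendsto G₀ (𝓝[ball 0 1] ξ) (𝓝 (L ξ + 1 / ξ)) := by
    intro ξ hξ
    have hξ0 : ξ ≠ 0 := ne_of_mem_sphere hξ one_ne_zero
    have h1 : Tendsto (fun η : ℂ => 1 / η) (𝓝[ball 0 1] ξ) (𝓝 (1 / ξ)) :=
      (((continuousAt_const).div continuousAt_id hξ0).tendsto).mono_left nhdsWithin_le_nhds
    refine ((hL ξ hξ).add h1).congr' ?_
    filter_upwards [self_mem_nhdsWithin, nhdsWithin_le_nhds (eventually_ne_nhds hξ0)] with η h2 h3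
    exact (hΛ η h2 h3).symm
  have hcl : closure (ball (0 : ℂ) 1) = closedBall 0 1 := closure_ball 0 one_ne_zero
  refine ⟨extendFrom (ball 0 1) G₀, ⟨?_, ?_⟩, ?_⟩
  · exact hG₀d.congr fun η hη => extendFrom_extends hG₀d.continuousOn η hη
  · refine continuousOn_extendFrom subset_rfl fun ξ hξ => ?_
    rw [hcl, ← ball_union_sphere] at hξ
    rcases hξ with hξ | hξ
    · exact ⟨_, hG₀d.continuousOn ξ hξ⟩
    · exact ⟨_, hlim ξ hξ⟩
  · intro ξ hξ
    rw [extendFrom_eq (hcl ▸ sphere_subset_closedBall hξ) (hlim ξ hξ)]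
    ring
/-- The coefficients of a polynomial of bounded degree are fixed linear combinations of its values
at finitely many points of the closed unit disc. -/
theorem Polynomial.exists_coeff_eq_sum_eval (n : ℕ) :
    ∃ (v : ℕ → ℂ) (w : ℕ → ℕ → ℂ), (∀ j, v j ∈ closedBall (0 : ℂ) 1) ∧
      ∀ q : ℂ[X], q.natDegree ≤ n → ∀ i,
        q.coeff i = ∑ j ∈ Finset.range (n + 1), w i j * q.eval (v j) := by
  set v : ℕ → ℂ := fun j => ((j : ℂ) + 1)⁻¹ with hv
  have hinj : Function.Injective v := by
    intro a b hab
    simpa [hv] using hab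
  refine ⟨v, fun i j => (Lagrange.basis (Finset.range (n + 1)) v j).coeff i, ?_, ?_⟩
  · intro j
    rw [mem_closedBall_zero_iff, norm_inv]
    apply inv_le_one_of_one_le₀
    have : ((j : ℂ) + 1) = ((j + 1 : ℕ) : ℂ) := by push_cast; ring
    rw [this, Complex.norm_natCast]
    exact_mod_cast Nat.le_add_left 1 j
  · intro q hq i
    have hlt : q.degree < (Finset.range (n + 1)).card := by
      rw [Finset.card_range]
      exact (Polynomial.degree_le_of_natDegree_le hq).trans_lt
        (by exact_mod_cast Nat.lt_succ_self n)
    conv_lhs => rw [Lagrange.eq_interpolate (s := Finset.range (n + 1)) (v := v) hinj.injOn hlt,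
      Lagrange.interpolate_apply, Polynomial.finsetSum_coeff]
    exact Finset.sum_congr rfl fun j _ => by rw [Polynomial.coeff_C_mul, mul_comm]

theorem exists_hasDerivWithinAt_coeff {n : ℕ} {p : ℝ → ℂ[X]} {s : Set ℝ}
    (hdeg : ∀ t ∈ s, (p t).natDegree ≤ n)
    (hp : ∀ ξ ∈ closedBall (0 : ℂ) 1, DifferentiableOn ℝ (fun t => (p t).eval ξ) s)
    {t : ℝ} (ht : t ∈ s) :
    ∃ a' : ℕ → ℂ, ∀ i, HasDerivWithinAt (fun τ => (p τ).coeff i) (a' i) s t := by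
  obtain ⟨v, w, hv, hw⟩ := Polynomial.exists_coeff_eq_sum_eval n
  refine ⟨fun i => ∑ j ∈ Finset.range (n + 1),
    w i j * derivWithin (fun τ => (p τ).eval (v j)) s t, fun i => ?_⟩
  have h : HasDerivWithinAt (fun τ => ∑ j ∈ Finset.range (n + 1), w i j * (p τ).eval (v j))
      (∑ j ∈ Finset.range (n + 1), w i j * derivWithin (fun τ => (p τ).eval (v j)) s t) s t :=
    HasDerivWithinAt.fun_sum fun j _ => ((hp (v j) (hv j) t ht).hasDerivWithinAt).const_mul _
  exact h.congr (fun τ hτ => hw _ (hdeg τ hτ) i) (hw _ (hdeg t ht) i)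

/-- The moments evolve linearly: `C_0' = 2`, and `C_k' = 0` for `k ≥ 1`. By Cauchy's theorem only
the pole `-1/ξ` of `Λ'` contributes to the moments of the equation. -/
theorem IsGlobalStokesSolution.hasDerivWithinAt_stokesMoment {n : ℕ} {p : ℝ → ℂ[X]}
    {f : ℂ → ℝ → ℂ} (hf : ∀ (ξ : ℂ) (t : ℝ), f ξ t = (p t).eval ξ)
    (hdeg : ∀ t : ℝ, 0 ≤ t → (p t).natDegree ≤ n) (hsol : IsGlobalStokesSolution f) (k : ℕ)
    {t : ℝ} (ht : 0 ≤ t) :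
    HasDerivWithinAt (stokesMoment f k) (2 * 0 ^ k) (Ici 0) t := by
  obtain ⟨a', ha'⟩ := exists_hasDerivWithinAt_coeff (s := Ici 0) hdeg
    (fun ξ hξ => by
      simpa only [hf] using (hsol.contDiff_time ξ hξ).differentiableOn one_ne_zero) ht
  set c : ℕ → ℕ → ℂ := fun i j =>
    i * a' i * conj ((p t).coeff j) + i * (p t).coeff i * conj (a' j) with hc
  have hterm : ∀ i j : ℕ, HasDerivWithinAt
      (fun τ => i * (p τ).coeff i * conj ((p τ).coeff j)) (c i j) (Ici 0) t := fun i j =>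
    ((ha' i).const_mul (i : ℂ)).mul (ha' j).star
  have hmom : HasDerivWithinAt (stokesMoment f k)
      (∑ i ∈ Finset.range (n + 1), ∑ j ∈ Finset.range (n + 1), if i + k = j then c i j else 0)
      (Ici 0) t := by
    have h : HasDerivWithinAt (fun τ => ∑ i ∈ Finset.range (n + 1), ∑ j ∈ Finset.range (n + 1),
        if i + k = j then i * (p τ).coeff i * conj ((p τ).coeff j) else 0)
        (∑ i ∈ Finset.range (n + 1), ∑ j ∈ Finset.range (n + 1), if i + k = j then c i j else 0)
        (Ici 0) t := by
      refine HasDerivWithinAt.fun_sum fun i _ => HasDerivWithinAt.fun_sum fun j _ => ?_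
      split_ifs
      · exact hterm i j
      · exact hasDerivWithinAt_const _ _ _
    exact h.congr (fun τ hτ => stokesMoment_eq_sum_sum hf (hdeg τ hτ) k)
      (stokesMoment_eq_sum_sum hf (hdeg t ht) k)
  have hdens : ∀ ξ ∈ sphere (0 : ℂ) 1,
      HasDerivWithinAt (fun s : ℝ => stokesDensity (fun ζ => f ζ s) ξ)
        (∑ i ∈ Finset.range (n + 1), ∑ j ∈ Finset.range (n + 1), c i j * ξ ^ ((i : ℤ) - 1 - j))
        (Ici 0) t := by
    intro ξ hξ
    have h : HasDerivWithinAt (fun τ => ∑ i ∈ Finset.range (n + 1), ∑ j ∈ Finset.range (n + 1),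
        (i * (p τ).coeff i * conj ((p τ).coeff j)) * ξ ^ ((i : ℤ) - 1 - j))
        (∑ i ∈ Finset.range (n + 1), ∑ j ∈ Finset.range (n + 1), c i j * ξ ^ ((i : ℤ) - 1 - j))
        (Ici 0) t :=
      HasDerivWithinAt.fun_sum fun i _ => HasDerivWithinAt.fun_sum fun j _ =>
        (hterm i j).mul_const _
    have heq : ∀ τ ∈ Ici (0 : ℝ), stokesDensity (fun ζ => f ζ τ) ξ =
        ∑ i ∈ Finset.range (n + 1), ∑ j ∈ Finset.range (n + 1),
          (i * (p τ).coeff i * conj ((p τ).coeff j)) * ξ ^ ((i : ℤ) - 1 - j) := by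
      intro τ hτ
      simp only [hf]
      exact stokesDensity_eval_eq_sum (hdeg τ hτ) hξ
    exact h.congr heq (heq t ht)
  obtain ⟨dχ, hχ, hbdry⟩ := hsol.equation t ht
  choose! L hL D hD hDL using hbdry
  obtain ⟨G, hG, hLG⟩ := hχ.exists_diffContOnCl (hsol.univalentNormalized t ht) hL
  have hval : ∀ ξ ∈ sphere (0 : ℂ) 1,
      ∑ i ∈ Finset.range (n + 1), ∑ j ∈ Finset.range (n + 1), c i j * ξ ^ ((i : ℤ) - 1 - j) =
        2 / ξ - 2 * G ξ := by
    intro ξ hξ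
    rw [(uniqueDiffOn_Ici (0 : ℝ) t ht).eq_deriv _ (hdens ξ hξ) (hD ξ hξ),
      eq_neg_of_add_eq_zero_left (hDL ξ hξ), hLG ξ hξ]
    ring
  convert hmom using 1
  rw [← circleIntegral_pow_mul_laurent_sum n k c]
  -- The integrand is `H(ξ) / ξ` with `H` as below; Cauchy's formula gives `H(0) = 2 * 0 ^ k`.
  have hH : DiffContOnCl ℂ (fun ξ : ℂ => ξ ^ k * (2 - 2 * (ξ * G ξ))) (ball 0 1) := by
    have hid : DiffContOnCl ℂ (fun ξ : ℂ => ξ) (ball 0 1) := differentiable_id.diffContOnCl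
    have h1 : DiffContOnCl ℂ (fun ξ : ℂ => ξ * G ξ) (ball 0 1) := hid.smul hG
    have h2 : DiffContOnCl ℂ (fun ξ : ℂ => 2 - 2 * (ξ * G ξ)) (ball 0 1) :=
      (h1.const_smul (2 : ℂ)).const_sub 2
    have h3 : DiffContOnCl ℂ (fun ξ : ℂ => ξ ^ k) (ball 0 1) :=
      (differentiable_pow k).diffContOnCl
    exact h3.smul h2
  have hint : (∮ ξ in C((0 : ℂ), 1), ξ ^ k * ∑ i ∈ Finset.range (n + 1),
      ∑ j ∈ Finset.range (n + 1), c i j * ξ ^ ((i : ℤ) - 1 - j)) =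
      ∮ ξ in C((0 : ℂ), 1), (ξ - 0)⁻¹ • (ξ ^ k * (2 - 2 * (ξ * G ξ))) := by
    refine circleIntegral.integral_congr zero_le_one fun ξ hξ => ?_
    have hξ0 : ξ ≠ 0 := ne_of_mem_sphere hξ one_ne_zero
    rw [hval ξ hξ, sub_zero, smul_eq_mul]
    field_simp
  rw [hint, hH.circleIntegral_sub_inv_smul (mem_ball_self one_pos), smul_eq_mul,
    inv_mul_cancel_left₀ Complex.two_pi_I_ne_zero]
  ring

theorem IsGlobalStokesSolution.stokesMoment_eq {n : ℕ} {p : ℝ → ℂ[X]}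
    {f : ℂ → ℝ → ℂ} (hf : ∀ (ξ : ℂ) (t : ℝ), f ξ t = (p t).eval ξ)
    (hdeg : ∀ t : ℝ, 0 ≤ t → (p t).natDegree ≤ n) (hsol : IsGlobalStokesSolution f) (k : ℕ)
    {t : ℝ} (ht : 0 ≤ t) :
    stokesMoment f k t = stokesMoment f k 0 + t * (2 * 0 ^ k) := by
  have hd : ∀ s : ℝ, 0 ≤ s → HasDerivWithinAt
      (fun s : ℝ => stokesMoment f k s - s * (2 * 0 ^ k)) 0 (Ici 0) s := by
    intro s hs
    have h1 : HasDerivWithinAt (fun s : ℝ => (s : ℂ) * (2 * 0 ^ k)) (1 * (2 * 0 ^ k)) (Ici 0) s :=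
      (Complex.ofRealCLM.hasDerivWithinAt).mul_const _
    simpa using (hsol.hasDerivWithinAt_stokesMoment hf hdeg k hs).fun_sub h1
  have := constant_of_has_deriv_right_zero (a := 0) (b := t)
    (fun s hs => ((hd s hs.1).continuousWithinAt).mono fun x hx => hx.1)
    (fun s hs => (hd s hs.1).mono (Ici_subset_Ici.2 hs.1)) t (right_mem_Icc.2 ht)
  rw [Complex.ofReal_zero, zero_mul, sub_zero] at this
  rw [← this, sub_add_cancel]

/-! ### Coefficient bounds from univalence -/

/-- A polynomial without zeros in the open unit disc has its coefficients controlled by its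
constant term: after normalization, the reversed polynomial is monic with all roots in the closed
disc. -/
theorem Polynomial.norm_coeff_le_of_eval_ne_zero {q : ℂ[X]}
    (hq : ∀ z : ℂ, ‖z‖ < 1 → q.eval z ≠ 0) (i : ℕ) :
    ‖q.coeff i‖ ≤ 2 ^ q.natDegree * ‖q.coeff 0‖ := by
  have h0 : q.coeff 0 ≠ 0 := by
    rw [Polynomial.coeff_zero_eq_eval_zero]
    exact hq 0 (by simp)
  have htd : q.natTrailingDegree = 0 := Polynomial.natTrailingDegree_eq_zero.2 (Or.inr h0)
  rcases lt_or_ge q.natDegree i with hi | hi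
  · rw [Polynomial.coeff_eq_zero_of_natDegree_lt hi, norm_zero]
    positivity
  set r : ℂ[X] := Polynomial.C (q.coeff 0)⁻¹ * q.reverse with hr
  have hlead : q.reverse.leadingCoeff = q.coeff 0 := by
    rw [Polynomial.reverse_leadingCoeff, Polynomial.trailingCoeff, htd]
  have hmonic : r.Monic := by
    rw [Polynomial.Monic, hr, Polynomial.leadingCoeff_mul, hlead, Polynomial.leadingCoeff_C,
      inv_mul_cancel₀ h0]
  have hdeg : r.natDegree = q.natDegree := by
    rw [hr, Polynomial.natDegree_C_mul (inv_ne_zero h0), Polynomial.reverse_natDegree, htd,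
      Nat.sub_zero]
  have hroots : ∀ z ∈ (r.map (RingHom.id ℂ)).roots, ‖z‖ ≤ 1 := by
    intro z hz
    rw [Polynomial.map_id] at hz
    by_contra! hz1
    have hz0 : z ≠ 0 := by
      rintro rfl
      norm_num at hz1
    have hzr : q.reverse.eval z = 0 := by
      have := (Polynomial.mem_roots hmonic.ne_zero).1 hz
      rw [Polynomial.IsRoot, hr, Polynomial.eval_mul, Polynomial.eval_C] at this
      exact (mul_eq_zero.1 this).resolve_left (inv_ne_zero h0)
    let _ : Invertible (z⁻¹) := invertibleOfNonzero (inv_ne_zero hz0)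
    have key := (Polynomial.eval₂_reverse_eq_zero_iff (RingHom.id ℂ) (z⁻¹) q).1
      (by rw [invOf_eq_inv, inv_inv]; exact hzr)
    refine hq z⁻¹ ?_ key
    rw [norm_inv]
    exact inv_lt_one_of_one_lt₀ hz1
  have hbound := Polynomial.coeff_le_of_roots_le (q.natDegree - i) hmonic
    (IsAlgClosed.splits _) hroots
  rw [Polynomial.map_id, hr, Polynomial.coeff_C_mul, Polynomial.coeff_reverse,
    Polynomial.revAt_le (Nat.sub_le _ _), Nat.sub_sub_self hi, one_pow, one_mul, ← hr, hdeg,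
    norm_mul, norm_inv, inv_mul_le_iff₀ (norm_pos_iff.2 h0), mul_comm] at hbound
  refine hbound.trans ?_
  gcongr
  exact_mod_cast Nat.choose_le_two_pow _ _

/-- Univalence enters the asymptotics only here: `F(ξ)/ξ` has no zero in the disc, so every
coefficient is controlled by the first one. -/
theorem UnivalentNormalized.norm_coeff_le {q : ℂ[X]} {n : ℕ} (hq : q.natDegree ≤ n)
    (hu : UnivalentNormalized (closedBall 0 1) fun ξ => q.eval ξ) (i : ℕ) :
    ‖q.coeff i‖ ≤ 2 ^ n * ‖q.coeff 1‖ := by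
  have hc0 : q.coeff 0 = 0 := by
    rw [Polynomial.coeff_zero_eq_eval_zero]
    exact hu.map_zero
  rcases i with _ | i
  · rw [hc0, norm_zero]
    positivity
  have heval : ∀ z, q.eval z = q.divX.eval z * z := by
    intro z
    conv_lhs => rw [← Polynomial.divX_mul_X_add q, hc0]
    simp
  have hne : ∀ z : ℂ, ‖z‖ < 1 → q.divX.eval z ≠ 0 := by
    intro z hz hz0
    rcases eq_or_ne z 0 with rfl | hne
    · have h1 := hu.deriv_zero_re
      rw [Polynomial.deriv, ← Polynomial.coeff_zero_eq_eval_zero, Polynomial.coeff_derivative] at h1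
      rw [← Polynomial.coeff_zero_eq_eval_zero, Polynomial.coeff_divX] at hz0
      simp [hz0] at h1
    · refine hne (hu.univalent (by simpa using hz.le) (by simp) ?_)
      rw [heval z, heval 0, hz0, zero_mul, mul_zero]
  have h := Polynomial.norm_coeff_le_of_eval_ne_zero hne i
  rw [Polynomial.coeff_divX, Polynomial.coeff_divX, zero_add] at h
  refine h.trans ?_
  gcongr
  · norm_num
  · rw [Polynomial.natDegree_divX_eq_natDegree_tsub_one]
    omega

/-! ### Asymptotics of the coefficients -/

theorem Finset.sum_range_succ_eq_add_sum_Icc_two {n : ℕ} (hn : 1 ≤ n) {M : Type*}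
    [AddCommMonoid M] (g : ℕ → M) (hg : g 0 = 0) :
    ∑ i ∈ Finset.range (n + 1), g i = g 1 + ∑ i ∈ Finset.Icc 2 n, g i := by
  rw [Finset.range_eq_Ico, Finset.sum_eq_sum_Ico_succ_bot (by omega), hg, zero_add,
    Finset.sum_eq_sum_Ico_succ_bot (by omega)]
  rfl

/-- The properties of the coefficients of a polynomial solution that determine their asymptotics:
`a i` is the coefficient of `ξ ^ i`, it vanishes for `i > n`, the first coefficient is positive and
bounds all others up to the factor `2 ^ n`, the `k`-th moment is the constant `C k` for `k ≥ 1`, and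
the zeroth moment, or energy, is `2t + c`. -/
structure CoeffFlow (n : ℕ) (a : ℕ → ℝ → ℂ) (C : ℕ → ℂ) (c : ℝ) : Prop where
  eq_zero : ∀ t, 0 ≤ t → ∀ i, n < i → a i t = 0
  im_one : ∀ t, 0 ≤ t → (a 1 t).im = 0
  re_one : ∀ t, 0 ≤ t → 0 < (a 1 t).re
  norm_le : ∀ t, 0 ≤ t → ∀ i, ‖a i t‖ ≤ 2 ^ n * ‖a 1 t‖
  moment : ∀ t, 0 ≤ t → ∀ k, 1 ≤ k →
    ∑ i ∈ Finset.range (n + 1), i * a i t * conj (a (i + k) t) = C k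
  energy : ∀ t, 0 ≤ t → ∑ i ∈ Finset.range (n + 1), i * ‖a i t‖ ^ 2 = 2 * t + c

namespace CoeffFlow

variable {n : ℕ} {a : ℕ → ℝ → ℂ} {C : ℕ → ℂ} {c : ℝ}

theorem norm_one_eq (h : CoeffFlow n a C c) {t : ℝ} (ht : 0 ≤ t) : ‖a 1 t‖ = (a 1 t).re :=
  (Complex.re_eq_norm.2 (Complex.nonneg_iff.2 ⟨(h.re_one t ht).le, (h.im_one t ht).symm⟩)).symm

theorem one_eq_ofReal_norm (h : CoeffFlow n a C c) {t : ℝ} (ht : 0 ≤ t) :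
    a 1 t = (‖a 1 t‖ : ℝ) := by
  rw [h.norm_one_eq ht]
  exact Complex.ext (by simp) (by simp [h.im_one t ht])

theorem norm_one_pos (h : CoeffFlow n a C c) {t : ℝ} (ht : 0 ≤ t) : 0 < ‖a 1 t‖ := by
  rw [h.norm_one_eq ht]
  exact h.re_one t ht

theorem tendsto_norm_one (h : CoeffFlow n a C c) : Tendsto (fun t => ‖a 1 t‖) atTop atTop := by
  set K : ℝ := ∑ i ∈ Finset.range (n + 1), (i : ℝ) * (2 ^ n) ^ 2 + 1 with hK
  have hKpos : 0 < K := by positivity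
  have hle : ∀ t, 0 ≤ t → (2 * t + c) / K ≤ ‖a 1 t‖ ^ 2 := by
    intro t ht
    rw [div_le_iff₀' hKpos, ← h.energy t ht, hK, add_mul, Finset.sum_mul]
    have : ∑ i ∈ Finset.range (n + 1), (i : ℝ) * ‖a i t‖ ^ 2 ≤
        ∑ i ∈ Finset.range (n + 1), (i : ℝ) * (2 ^ n) ^ 2 * ‖a 1 t‖ ^ 2 := by
      refine Finset.sum_le_sum fun i _ => ?_
      rw [mul_assoc, ← mul_pow]
      gcongr
      exact h.norm_le t ht i
    have h2 : 0 ≤ 1 * ‖a 1 t‖ ^ 2 := by positivity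
    linarith
  have hlin : Tendsto (fun t : ℝ => (2 * t + c) / K) atTop atTop :=
    ((tendsto_id.const_mul_atTop two_pos).atTop_add tendsto_const_nhds).atTop_div_const hKpos
  refine tendsto_atTop_mono' _ ?_ (Real.tendsto_sqrt_atTop.comp hlin)
  filter_upwards [eventually_ge_atTop 0] with t ht
  exact Real.sqrt_le_iff.2 ⟨norm_nonneg _, hle t ht⟩

/-- The part of the `k`-th moment that does not involve `a 1`. -/
def tail (n : ℕ) (a : ℕ → ℝ → ℂ) (k : ℕ) (t : ℝ) : ℂ :=
  ∑ i ∈ Finset.Icc 2 n, i * a i t * conj (a (i + k) t)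

theorem one_mul_conj_eq (h : CoeffFlow n a C c) (hn : 1 ≤ n) {k : ℕ} (hk : 1 ≤ k) {t : ℝ}
    (ht : 0 ≤ t) : a 1 t * conj (a (k + 1) t) = C k - tail n a k t := by
  rw [← h.moment t ht k hk, Finset.sum_range_succ_eq_add_sum_Icc_two hn _ (by simp), tail,
    add_comm k 1]
  simp

/-- Descending induction on `k`: dividing the moment equation by `a 1` expresses `a (k + 1)`
through `C k / a 1` and the coefficients of higher index, weighted by the bounded ratios
`a i / a 1`. -/
theorem tendsto_zero (h : CoeffFlow n a C c) (hn : 1 ≤ n) {k : ℕ} (hk : 2 ≤ k) :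
    Tendsto (a k) atTop (𝓝 0) := by
  suffices H : ∀ d k : ℕ, 2 ≤ k → n < k + d → Tendsto (a k) atTop (𝓝 0) from
    H (n + 1) k hk (by omega)
  intro d
  induction d with
  | zero =>
    intro k _ hnk
    refine tendsto_const_nhds.congr' ?_
    filter_upwards [eventually_ge_atTop 0] with t ht
    exact (h.eq_zero t ht k hnk).symm
  | succ d ih =>
    intro k hk hnk
    obtain ⟨m, rfl⟩ : ∃ m, k = m + 1 := ⟨k - 1, by omega⟩
    have hbound : Tendsto (fun t => ‖C m‖ / ‖a 1 t‖ +
        ∑ i ∈ Finset.Icc 2 n, (i * 2 ^ n : ℝ) * ‖a (i + m) t‖) atTop (𝓝 0) := by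
      have h1 : Tendsto (fun t => ‖C m‖ / ‖a 1 t‖) atTop (𝓝 0) :=
        h.tendsto_norm_one.const_div_atTop _
      have h2 : Tendsto (fun t => ∑ i ∈ Finset.Icc 2 n, (i * 2 ^ n : ℝ) * ‖a (i + m) t‖) atTop
          (𝓝 (∑ i ∈ Finset.Icc 2 n, (i * 2 ^ n : ℝ) * 0)) := by
        refine tendsto_finsetSum _ fun i hi => ?_
        have hi2 := (Finset.mem_Icc.1 hi).1
        exact ((tendsto_zero_iff_norm_tendsto_zero.1
          (ih (i + m) (by omega) (by omega))).const_mul _)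
      simpa using h1.add h2
    refine squeeze_zero_norm' ?_ hbound
    filter_upwards [eventually_ge_atTop 0] with t ht
    have hpos := h.norm_one_pos ht
    have hmul : ‖a 1 t‖ * ‖a (m + 1) t‖ = ‖C m - tail n a m t‖ := by
      rw [← h.one_mul_conj_eq hn (by omega) ht, norm_mul, RCLike.norm_conj]
    have htail : ‖tail n a m t‖ ≤
        ‖a 1 t‖ * ∑ i ∈ Finset.Icc 2 n, (i * 2 ^ n : ℝ) * ‖a (i + m) t‖ := by
      rw [tail, Finset.mul_sum]
      refine norm_sum_le_of_le _ fun i _ => ?_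
      rw [norm_mul, norm_mul, RCLike.norm_conj, Complex.norm_natCast]
      calc (i : ℝ) * ‖a i t‖ * ‖a (i + m) t‖ ≤ i * (2 ^ n * ‖a 1 t‖) * ‖a (i + m) t‖ := by
            gcongr
            exact h.norm_le t ht i
        _ = _ := by ring
    have := norm_sub_le (C m) (tail n a m t)
    refine le_of_mul_le_mul_left ?_ hpos
    rw [hmul, mul_add, mul_div_cancel₀ _ hpos.ne']
    linarith

theorem tendsto_one_mul_conj (h : CoeffFlow n a C c) (hn : 1 ≤ n) {k : ℕ} (hk : 1 ≤ k) :
    Tendsto (fun t => a 1 t * conj (a (k + 1) t)) atTop (𝓝 (C k)) := by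
  have htail : Tendsto (tail n a k) atTop (𝓝 0) := by
    have : Tendsto (tail n a k) atTop (𝓝 (∑ i ∈ Finset.Icc 2 n, (i : ℂ) * 0 * conj 0)) := by
      refine tendsto_finsetSum _ fun i hi => ?_
      have hi2 := (Finset.mem_Icc.1 hi).1
      exact ((h.tendsto_zero hn hi2).const_mul _).mul
        ((Complex.continuous_conj.tendsto 0).comp (h.tendsto_zero hn (by omega)))
    simpa using this
  have h1 : Tendsto (fun t => C k - tail n a k t) atTop (𝓝 (C k)) := by
    simpa using htail.const_sub (C k)
  refine h1.congr' ?_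
  filter_upwards [eventually_ge_atTop 0] with t ht
  exact (h.one_mul_conj_eq hn hk ht).symm

theorem tendsto_energy_tail (h : CoeffFlow n a C c) (hn : 1 ≤ n) :
    Tendsto (fun t => ∑ i ∈ Finset.Icc 2 n, (i : ℝ) * ‖a i t‖ ^ 2) atTop (𝓝 0) := by
  have : Tendsto (fun t => ∑ i ∈ Finset.Icc 2 n, (i : ℝ) * ‖a i t‖ ^ 2) atTop
      (𝓝 (∑ i ∈ Finset.Icc 2 n, (i : ℝ) * 0 ^ 2)) := by
    refine tendsto_finsetSum _ fun i hi => ?_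
    exact ((tendsto_zero_iff_norm_tendsto_zero.1
      (h.tendsto_zero hn (Finset.mem_Icc.1 hi).1)).pow 2).const_mul _
  simpa using this

theorem norm_one_sq_add (h : CoeffFlow n a C c) (hn : 1 ≤ n) {t : ℝ} (ht : 0 ≤ t) :
    ‖a 1 t‖ ^ 2 + ∑ i ∈ Finset.Icc 2 n, (i : ℝ) * ‖a i t‖ ^ 2 = 2 * t + c := by
  rw [← h.energy t ht, Finset.sum_range_succ_eq_add_sum_Icc_two hn _ (by simp)]
  simp

theorem tendsto_sqrt_div_norm_one (h : CoeffFlow n a C c) (hn : 1 ≤ n) :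
    Tendsto (fun t => √(2 * t) / ‖a 1 t‖) atTop (𝓝 1) := by
  -- By the energy identity the function below is `2t / (a 1)²`.
  have h1 : Tendsto (fun t => 1 - (c - ∑ i ∈ Finset.Icc 2 n, (i : ℝ) * ‖a i t‖ ^ 2) /
      ‖a 1 t‖ ^ 2) atTop (𝓝 1) := by
    simpa using (((h.tendsto_energy_tail hn).const_sub c).div_atTop
      ((tendsto_pow_atTop two_ne_zero).comp h.tendsto_norm_one)).const_sub 1
  have h2 := h1.sqrt
  rw [Real.sqrt_one] at h2
  refine h2.congr' ?_
  filter_upwards [eventually_ge_atTop 0] with t ht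
  have hpos := h.norm_one_pos ht
  have hE := h.norm_one_sq_add hn ht
  rw [show 1 - (c - ∑ i ∈ Finset.Icc 2 n, (i : ℝ) * ‖a i t‖ ^ 2) / ‖a 1 t‖ ^ 2 =
      2 * t / ‖a 1 t‖ ^ 2 by field_simp; linarith,
    Real.sqrt_div (by positivity), Real.sqrt_sq hpos.le]

theorem tendsto_mul_sqrt (h : CoeffFlow n a C c) (hn : 1 ≤ n) {k : ℕ} (hk : 2 ≤ k) :
    Tendsto (fun t => a k t * (√(2 * t) : ℝ)) atTop (𝓝 (conj (C (k - 1)))) := by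
  obtain ⟨m, rfl⟩ : ∃ m, k = m + 1 := ⟨k - 1, by omega⟩
  rw [Nat.add_sub_cancel]
  have h1 := ((Complex.continuous_conj.tendsto _).comp
    (h.tendsto_one_mul_conj hn (k := m) (by omega))).mul
      ((Complex.continuous_ofReal.tendsto _).comp (h.tendsto_sqrt_div_norm_one hn))
  rw [Complex.ofReal_one, mul_one] at h1
  refine h1.congr' ?_
  filter_upwards [eventually_ge_atTop 0] with t ht
  have hpos : (‖a 1 t‖ : ℂ) ≠ 0 := Complex.ofReal_ne_zero.2 (h.norm_one_pos ht).ne'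
  simp only [Function.comp_apply, map_mul, Complex.conj_conj, Complex.ofReal_div]
  rw [h.one_eq_ofReal_norm ht, Complex.conj_ofReal, Complex.norm_real, norm_norm]
  field_simp

theorem tendsto_one_sub_sqrt_mul_sqrt (h : CoeffFlow n a C c) (hn : 1 ≤ n) :
    Tendsto (fun t => (a 1 t - (√(2 * t + c) : ℝ)) * (√(2 * t) : ℝ)) atTop (𝓝 0) := by
  have h1 := (h.tendsto_energy_tail hn).mul (h.tendsto_sqrt_div_norm_one hn)
  rw [zero_mul] at h1
  refine squeeze_zero_norm' ?_ h1
  filter_upwards [eventually_ge_atTop 0] with t ht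
  have hpos := h.norm_one_pos ht
  have hE := h.norm_one_sq_add hn ht
  set E := ∑ i ∈ Finset.Icc 2 n, (i : ℝ) * ‖a i t‖ ^ 2 with hEdef
  have hE0 : 0 ≤ E := by positivity
  have hsq : √(2 * t + c) ^ 2 = 2 * t + c := Real.sq_sqrt (by rw [← hE]; positivity)
  have hle : ‖a 1 t‖ ≤ √(2 * t + c) := Real.le_sqrt_of_sq_le (by linarith)
  -- `(√(2t + c) - a 1) (√(2t + c) + a 1) = E`, and the second factor is at least `a 1`.
  have hdiff : (√(2 * t + c) - ‖a 1 t‖) * ‖a 1 t‖ ≤ E := by nlinarith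
  rw [norm_mul, Complex.norm_real, Real.norm_of_nonneg (Real.sqrt_nonneg (2 * t)),
    h.one_eq_ofReal_norm ht, ← Complex.ofReal_sub, Complex.norm_real, norm_sub_rev,
    Real.norm_of_nonneg (sub_nonneg.2 (by simpa using hle)), Complex.norm_real, norm_norm,
    mul_div_left_comm, mul_comm]
  gcongr
  rwa [le_div_iff₀ hpos]

end CoeffFlow

/-! ### Convergence of the solution -/

theorem tendstoLocallyUniformly_sum_mul_pow (s : Finset ℕ) {ι : Type*} {l : Filter ι}
    {b : ℕ → ι → ℂ} {β : ℕ → ℂ} (hb : ∀ i ∈ s, Tendsto (b i) l (𝓝 (β i))) :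
    TendstoLocallyUniformly (fun t (ξ : ℂ) => ∑ i ∈ s, b i t * ξ ^ i)
      (fun ξ => ∑ i ∈ s, β i * ξ ^ i) l := by
  have h : Tendsto (fun t => ∑ i ∈ s, b i t • (⟨fun ξ => ξ ^ i, continuous_pow i⟩ : C(ℂ, ℂ))) l
      (𝓝 (∑ i ∈ s, β i • (⟨fun ξ => ξ ^ i, continuous_pow i⟩ : C(ℂ, ℂ)))) :=
    tendsto_finsetSum _ fun i hi => (hb i hi).smul_const _
  simpa [Finset.sum_fn] using ContinuousMap.tendsto_iff_tendstoLocallyUniformly.1 h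

theorem IsGlobalStokesSolution.coeffFlow {n : ℕ} {p : ℝ → ℂ[X]} {f : ℂ → ℝ → ℂ}
    (hf : ∀ (ξ : ℂ) (t : ℝ), f ξ t = (p t).eval ξ)
    (hdeg : ∀ t : ℝ, 0 ≤ t → (p t).natDegree ≤ n) (hsol : IsGlobalStokesSolution f) :
    CoeffFlow n (fun i t => (p t).coeff i) (fun k => stokesMoment f k 0)
      (stokesMoment f 0 0).re := by
  have hu : ∀ t, 0 ≤ t → UnivalentNormalized (closedBall 0 1) fun ξ => (p t).eval ξ := by
    intro t ht
    simpa only [hf] using hsol.univalentNormalized t ht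
  have hd : ∀ t, deriv (fun ξ => (p t).eval ξ) 0 = (p t).coeff 1 := by
    intro t
    rw [Polynomial.deriv, ← Polynomial.coeff_zero_eq_eval_zero, Polynomial.coeff_derivative]
    simp
  refine ⟨fun t ht i hi => Polynomial.coeff_eq_zero_of_natDegree_lt ((hdeg t ht).trans_lt hi),
    fun t ht => ?_, fun t ht => ?_, fun t ht i => (hu t ht).norm_coeff_le (hdeg t ht) i,
    fun t ht k hk => ?_, fun t ht => ?_⟩
  · rw [← hd]
    exact (hu t ht).deriv_zero_im
  · rw [← hd]
    exact (hu t ht).deriv_zero_re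
  · rw [← stokesMoment_eq_sum hf (hdeg t ht), hsol.stokesMoment_eq hf hdeg k ht,
      zero_pow (by omega), mul_zero, mul_zero, add_zero]
  · have h1 := hsol.stokesMoment_eq hf hdeg 0 ht
    rw [stokesMoment_eq_sum hf (hdeg t ht)] at h1
    have h2 := congrArg Complex.re h1
    simp only [add_zero, mul_assoc, Complex.mul_conj, Complex.normSq_eq_norm_sq, pow_zero,
      mul_one] at h2
    rw [← Complex.ofReal_ofNat, ← Complex.ofReal_mul, Complex.add_re, Complex.ofReal_re,
      Complex.re_sum] at h2
    rw [show 2 * t + (stokesMoment f 0 0).re = (stokesMoment f 0 0).re + t * 2 by ring, ← h2]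
    refine Finset.sum_congr rfl fun i _ => ?_
    rw [← Complex.ofReal_natCast, ← Complex.ofReal_mul, Complex.ofReal_re]

theorem mainTheorem3 (n : ℕ) (hn : 2 ≤ n) (p : ℝ → ℂ[X]) (f : ℂ → ℝ → ℂ)
    (hf : ∀ (ξ : ℂ) (t : ℝ), f ξ t = (p t).eval ξ)
    (hdeg : ∀ t : ℝ, 0 ≤ t → (p t).natDegree = n)
    (hsol : IsGlobalStokesSolution f) :
    (stokesMoment f 0 0).im = 0 ∧
    (∀ k : ℕ, 1 ≤ k → ∀ t : ℝ, 0 ≤ t → stokesMoment f k t = stokesMoment f k 0) ∧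
    TendstoLocallyUniformly
      (fun (t : ℝ) (ξ : ℂ) =>
        (f ξ t - (√(2 * t + (stokesMoment f 0 0).re) : ℝ) * ξ) * (√(2 * t) : ℝ))
      (fun ξ : ℂ => ∑ k ∈ Finset.Icc 2 n, conj (stokesMoment f (k - 1) 0) * ξ ^ k)
      atTop ∧
    ∃ ξ : ℂ, ∑ k ∈ Finset.Icc 2 n, conj (stokesMoment f (k - 1) 0) * ξ ^ k ≠ 0 := by
  have hn1 : 1 ≤ n := by omega
  have hle : ∀ t : ℝ, 0 ≤ t → (p t).natDegree ≤ n := fun t ht => (hdeg t ht).le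
  have hflow := hsol.coeffFlow hf hle
  refine ⟨?_, fun k hk t ht => ?_, ?_, ?_⟩
  · rw [stokesMoment_eq_sum hf (hle 0 le_rfl), Complex.im_sum]
    refine Finset.sum_eq_zero fun i _ => ?_
    rw [add_zero, mul_assoc, Complex.mul_conj, ← Complex.ofReal_natCast, ← Complex.ofReal_mul,
      Complex.ofReal_im]
  · rw [hsol.stokesMoment_eq hf hle k ht, zero_pow (by omega), mul_zero, mul_zero, add_zero]
  · set A : ℕ → ℝ → ℂ := fun i t =>
      ((p t).coeff i - if i = 1 then ((√(2 * t + (stokesMoment f 0 0).re) : ℝ) : ℂ) else 0) *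
        (√(2 * t) : ℝ) with hA
    set B : ℕ → ℂ := fun i => if i = 1 then 0 else conj (stokesMoment f (i - 1) 0) with hB
    have hAB : ∀ i ∈ Finset.Icc 1 n, Tendsto (A i) atTop (𝓝 (B i)) := by
      intro i hi
      rcases eq_or_ne i 1 with rfl | hi1
      · simpa [hA, hB] using hflow.tendsto_one_sub_sqrt_mul_sqrt hn1
      · have hi2 : 2 ≤ i := by have := (Finset.mem_Icc.1 hi).1; omega
        simpa [hA, hB, hi1] using hflow.tendsto_mul_sqrt hn1 hi2
    have hIcc : Finset.Icc 1 n = insert 1 (Finset.Icc 2 n) :=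
      (Finset.insert_Icc_add_one_left_eq_Icc hn1).symm
    have hmem : 1 ∉ Finset.Icc 2 n := by simp
    have hne : ∀ i ∈ Finset.Icc 2 n, i ≠ 1 := fun i hi h => hmem (h ▸ hi)
    have hBsum : ∀ ξ : ℂ, ∑ i ∈ Finset.Icc 1 n, B i * ξ ^ i =
        ∑ k ∈ Finset.Icc 2 n, conj (stokesMoment f (k - 1) 0) * ξ ^ k := by
      intro ξ
      rw [hIcc, Finset.sum_insert hmem]
      simp only [hB, if_true, zero_mul, zero_add]
      exact Finset.sum_congr rfl fun i hi => by rw [if_neg (hne i hi)]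
    have key := tendstoLocallyUniformly_sum_mul_pow (Finset.Icc 1 n) hAB
    simp only [hBsum] at key
    intro u hu ξ₀
    obtain ⟨V, hV, hkey⟩ := key u hu ξ₀
    refine ⟨V, hV, ?_⟩
    filter_upwards [hkey, eventually_ge_atTop 0] with t hkey ht ξ hξ
    convert hkey ξ hξ using 2
    have hp0 : (p t).coeff 0 = 0 := by
      rw [Polynomial.coeff_zero_eq_eval_zero, ← hf]
      exact (hsol.univalentNormalized t ht).map_zero
    rw [hf, Polynomial.eval_eq_sum_range' (Nat.lt_succ_of_le (hle t ht)),
      Finset.sum_range_succ_eq_add_sum_Icc_two hn1 _ (by simp [hp0]), hIcc,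
      Finset.sum_insert hmem, add_sub_right_comm,
      add_mul, Finset.sum_mul]
    congr 1
    · simp only [hA, if_true]
      ring
    · refine Finset.sum_congr rfl fun i hi => ?_
      simp only [hA, if_neg (hne i hi)]
      ring
  · -- The top coefficient of the limit is `conj (C_{n-1})`, and `C_{n-1} = a_1 conj a_n ≠ 0`.
    set Q : ℂ[X] := ∑ k ∈ Finset.Icc 2 n,
      Polynomial.monomial k (conj (stokesMoment f (k - 1) 0)) with hQ
    have hcoeff : Q.coeff n = conj (stokesMoment f (n - 1) 0) := by
      rw [hQ, Polynomial.finsetSum_coeff]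
      simp only [Polynomial.coeff_monomial]
      rw [Finset.sum_ite_eq', if_pos (Finset.mem_Icc.2 ⟨hn, le_rfl⟩)]
    have hmoment : stokesMoment f (n - 1) 0 = (p 0).coeff 1 * conj ((p 0).coeff n) := by
      have htail : CoeffFlow.tail n (fun i t => (p t).coeff i) (n - 1) 0 = 0 := by
        refine Finset.sum_eq_zero fun i hi => ?_
        have hi2 := (Finset.mem_Icc.1 hi).1
        simp only
        rw [hflow.eq_zero 0 le_rfl (i + (n - 1)) (by omega), map_zero, mul_zero]
      have h := hflow.one_mul_conj_eq hn1 (k := n - 1) (by omega) le_rfl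
      rw [htail, sub_zero, Nat.sub_add_cancel hn1] at h
      exact h.symm
    have hQ0 : Q ≠ 0 := by
      intro h
      rw [h, Polynomial.coeff_zero, eq_comm, map_eq_zero, hmoment, mul_eq_zero,
        map_eq_zero] at hcoeff
      rcases hcoeff with h1 | h1
      · exact norm_pos_iff.1 (hflow.norm_one_pos le_rfl) h1
      · rw [← hdeg 0 le_rfl, Polynomial.coeff_natDegree, Polynomial.leadingCoeff_eq_zero] at h1
        have := hdeg 0 le_rfl
        rw [h1, Polynomial.natDegree_zero] at this
        omega
    by_contra! hzero
    refine hQ0 (Polynomial.funext fun ξ => ?_)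
    rw [hQ, Polynomial.eval_finsetSum, Polynomial.eval_zero, ← hzero ξ]
    simp only [Polynomial.eval_monomial]
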